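/- Setting. There are $M$ clients and a horizon of $T$ synchronous time steps. Client $i\in[M]$ has a set $\mathcal A_i\subset\mathbb R^d$ of $K$ unit vectors (arms) that span $\mathbb R^d$, and there is a finite set $\mathcal K\subset\mathbb R^d$ of unit vectors (key terms); these sets are known to the learner. For a constant $C\in(0,1)$, the key terms are rich with constant $C$ if for every unit vector $v\in\mathbb R^d$ some $k\in\mathcal K$ satisfies $k^{\mathsf T}v\ge C$. An unknown vector $\theta\in\mathbb R^d$ with $\|\theta\|\le 1$ is shared by all clients. At each time step $t\in[T]$, given the complete record of the choices and observations of all clients at the time steps before $t$, a (possibly randomized) policy draws for every client $i$ an arm $a_{i,t}\in\mathcal A_i$ and at most one key term $k_{i,t}\in\mathcal K$. It then observes $x_{i,t}=a_{i,t}^{\mathsf T}\theta+\eta_{i,t}$ and, if a key term was chosen, $\widetilde x_{i,t}=k_{i,t}^{\mathsf T}\theta+\widetilde\eta_{i,t}$, where all the noise terms are independent, the $\eta_{i,t}$ have a common $1$-subgaussian law, and so have the $\widetilde\eta_{i,t}$. The expected regret is \[ R_M(T)=\mathbb E\Big[\sum_{i=1}^M\sum_{t=1}^T\Big(\max_{a\in\mathcal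 A_i}a^{\mathsf T}\theta-a_{i,t}^{\mathsf T}\theta\Big)\Big]. \] Theorem (regret lower bound). There is an absolute constant $c>0$ such that the following holds for every $C\in(0,1)$ and all natural numbers $d,M,K,T$ with $d\ge 2$, $K\ge d$ and $MT\ge d$. For every policy that chooses at most one key term per client and time step (it may depend on $C$, $d$, $M$, $K$, $T$, the arm sets and the key terms), there is an instance of the federated conversational bandit problem, that is, arm sets $\mathcal A_1,\dots,\mathcal A_M$, a set $\mathcal K$ of key terms that is rich with constant $C$, a vector $\theta$ as above, and noise laws, which can be taken standard Gaussian, on which the policy suffers expected regret \[ R_M(T)\ \ge\ c\,\sqrt{dMT}. \] -/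

import Mathlib

open MeasureTheory ProbabilityTheory

noncomputable section

namespace FedBandit

/-- The publicly known part of a federated conversational bandit problem in dimension `d` with `M`
clients and `K` arms per client: the arm set of each client, enumerated by `Fin K`, and a finite set
of key terms, enumerated by `Fin numKeys`. All feature vectors are unit vectors and the arms of each
client span the space. -/
structure Setting (d M K : ℕ) where
  /-- the `K` arms of each client -/
  arm : Fin M → Fin K → EuclideanSpace ℝ (Fin d)
  arm_injective : ∀ i, Function.Injective (arm i)
  arm_norm : ∀ i k, ‖arm i k‖ = 1
  arm_span : ∀ i, Submodule.span ℝ (Set.range (arm i)) = ⊤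
  /-- the number of key terms -/
  numKeys : ℕ
  /-- the key terms -/
  key : Fin numKeys → EuclideanSpace ℝ (Fin d)
  key_injective : Function.Injective key
  key_norm : ∀ j, ‖key j‖ = 1

/-- The key terms are rich with constant `C`: every unit vector has inner product at least `C` with
some key term. -/
def Setting.RichKeyTerms {d M K : ℕ} (S : Setting d M K) (C : ℝ) : Prop :=
  ∀ v : EuclideanSpace ℝ (Fin d), ‖v‖ = 1 → ∃ j, C ≤ inner ℝ (S.key j) v

/-- The part of the problem that is unknown to the learner: the preference vector, of norm at most
`1`, shared by arms and key terms, and the laws of the arm-level and of the key-term-level noise,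
both `1`-subgaussian (and hence centered). -/
structure Environment (d : ℕ) where
  /-- the preference vector -/
  θ : EuclideanSpace ℝ (Fin d)
  norm_le : ‖θ‖ ≤ 1
  /-- the law of the noise in the rewards of the arms -/
  armNoise : Measure ℝ
  /-- the law of the noise in the feedback on the key terms -/
  keyNoise : Measure ℝ
  armNoise_prob : IsProbabilityMeasure armNoise
  keyNoise_prob : IsProbabilityMeasure keyNoise
  armNoise_subgaussian : HasSubgaussianMGF (fun x => x) 1 armNoise
  keyNoise_subgaussian : HasSubgaussianMGF (fun x => x) 1 keyNoise

instance instMeasurableSpaceOptionFin (n : ℕ) : MeasurableSpace (Option (Fin n)) := ⊤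

instance instDiscreteMeasurableSpaceOptionFin (n : ℕ) :
    DiscreteMeasurableSpace (Option (Fin n)) := ⟨fun _ => trivial⟩

/-- What is chosen in one time step: for each client, one arm and at most one key term. -/
abbrev Action (M K N : ℕ) : Type := Fin M → Fin K × Option (Fin N)

/-- What is observed in one time step: for each client, the reward of the arm and the feedback on
the key term. -/
abbrev Feedback (M : ℕ) : Type := Fin M → ℝ × ℝ

/-- The record of one time step. -/
abbrev Round (M K N : ℕ) : Type := Action M K N × Feedback M

/-- The record of the first `n` time steps. -/
abbrev History (M K N n : ℕ) : Type := Fin n → Round M K N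

/-- A (randomized) policy: in every time step, given the records of all clients in all previous time
steps, it draws one arm and at most one key term for every client, jointly. -/
structure Policy {d M K : ℕ} (S : Setting d M K) where
  /-- the conditional law of the choices in the time step that follows `n` completed ones -/
  act : (n : ℕ) → Kernel (History M K S.numKeys n) (Action M K S.numKeys)
  act_markov : ∀ n, IsMarkovKernel (act n)

section Law

variable {d M K : ℕ} (S : Setting d M K) (E : Environment d) (π : Policy S)

/-- The law of the reward `⟪a, θ⟫ + η` of an arm. -/
def armLaw (i : Fin M) (k : Fin K) : Measure ℝ :=
  E.armNoise.map (fun η => inner ℝ (S.arm i k) E.θ + η)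

/-- The law of the feedback `⟪k, θ⟫ + η` on a key term. If no key term is presented, the feedback
carries no information: it is `0`. -/
def keyLaw : Option (Fin S.numKeys) → Measure ℝ
  | none => Measure.dirac 0
  | some j => E.keyNoise.map (fun η => inner ℝ (S.key j) E.θ + η)

/-- The law of the feedback of one time step given the choices: independent over the clients and
over the two types of feedback. -/
def feedbackLaw (a : Action M K S.numKeys) : Measure (Feedback M) :=
  Measure.pi fun i => (armLaw S E i (a i).1).prod (keyLaw S E (a i).2)

/-- `feedbackLaw` as a kernel. -/
def feedback : Kernel (Action M K S.numKeys) (Feedback M) :=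
  Kernel.ofFunOfCountable (feedbackLaw S E)

/-- The conditional law of the next record given the history: choices are drawn by the policy, then
the feedback is drawn by the environment. -/
def step (n : ℕ) : Kernel (History M K S.numKeys n) (Round M K S.numKeys) :=
  π.act n ⊗ₖ Kernel.prodMkLeft (History M K S.numKeys n) (feedback S E)

/-- The law of the history of the first `n` time steps. -/
def law : (n : ℕ) → Measure (History M K S.numKeys n)
  | 0 => Measure.dirac Fin.elim0
  | n + 1 => (law n ⊗ₘ step S E π n).map fun p => Fin.snoc (α := fun _ => Round M K S.numKeys) p.1 p.2

/-- The cumulative regret of all clients along a history of `T` time steps. -/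
def regret {T : ℕ} (h : History M K S.numKeys T) : ℝ :=
  ∑ i : Fin M, ∑ t : Fin T, ((⨆ k : Fin K, inner ℝ (S.arm i k) E.θ) - inner ℝ (S.arm i ((h t).1 i).1) E.θ)

/-- The expected cumulative regret over the horizon `T`. -/
def expectedRegret (T : ℕ) : ℝ :=
  ∫ h, regret S E h ∂(law S E π T)

instance isProbabilityMeasure_armLaw (i : Fin M) (k : Fin K) :
    IsProbabilityMeasure (armLaw S E i k) := by
  have := E.armNoise_prob
  exact Measure.isProbabilityMeasure_map (by fun_prop)

instance isProbabilityMeasure_keyLaw (j : Option (Fin S.numKeys)) :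
    IsProbabilityMeasure (keyLaw S E j) := by
  have := E.keyNoise_prob
  cases j with
  | none => exact Measure.dirac.isProbabilityMeasure
  | some j => exact Measure.isProbabilityMeasure_map (by fun_prop)

instance isMarkovKernel_feedback : IsMarkovKernel (feedback S E) :=
  ⟨fun a => by
    change IsProbabilityMeasure (feedbackLaw S E a)
    unfold feedbackLaw
    infer_instance⟩

instance isMarkovKernel_step (n : ℕ) : IsMarkovKernel (step S E π n) := by
  have := π.act_markov n
  unfold step
  infer_instance

theorem measurable_snoc (M K N n : ℕ) :
    Measurable fun p : History M K N n × Round M K N =>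
      (Fin.snoc (α := fun _ => Round M K N) p.1 p.2 : History M K N (n + 1)) := by
  refine measurable_pi_iff.2 fun i => ?_
  refine Fin.lastCases ?_ (fun j => ?_) i
  · simpa using measurable_snd
  · simpa [Function.comp_def] using (measurable_pi_apply j).comp
      (measurable_fst : Measurable (Prod.fst : History M K N n × Round M K N → _))

instance isProbabilityMeasure_law (n : ℕ) : IsProbabilityMeasure (law S E π n) := by
  induction n with
  | zero => exact Measure.dirac.isProbabilityMeasure
  | succ n ih =>
    exact Measure.isProbabilityMeasure_map (measurable_snoc M K S.numKeys n).aemeasurable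

end Law

end FedBandit

end

/-! Give every client the standard basis among its arms and take `θ = Δ e_j` with `j` unknown.
Regret is then `Δ` times (`MT` minus the sum of the `j`-th coordinates of the played arms). Compare
with the null environment `θ = 0`. There the squared means that `Δ e_j` would produce, summed over
`j`, are at most `2Δ²` per client and step, since arm and key term have norm at most `1`: key terms
at most double the information, however rich they are. The coordinates of a unit vector sum to at
most `√d`, a fraction of `d` once `d ≥ 2`. So for `Δ² ≈ d/(MT)` some `j` is both hard to tell from
the null and rarely aligned with the play, which costs a constant times `ΔMT`.

The transfer from null to `Δ e_j` is `integral_law_gaussianEnv_le`. It needs no entropy chain rule: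
a Hellinger-type inequality bounds `|L - 1|`, for the likelihood ratio `L`, by terms whose null
means are explicit, because `L^(-1/2)` corrected by the information is the likelihood ratio of
`-θ/2`. `exists_le_expectedRegret` averages over `j`. -/

noncomputable section

/-! ### Product densities, Gaussian shifts and an elementary inequality -/

/-- The density of a product of probability measures is the product of the densities. -/
theorem pi_withDensity {ι : Type*} [Fintype ι] {α : ι → Type*} [∀ i, MeasurableSpace (α i)]
    (μ : ∀ i, Measure (α i)) [∀ i, IsProbabilityMeasure (μ i)] (f : ∀ i, α i → ENNReal)
    (hf : ∀ i, Measurable (f i)) [∀ i, SigmaFinite ((μ i).withDensity (f i))] :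
    Measure.pi (fun i => (μ i).withDensity (f i)) =
      (Measure.pi μ).withDensity fun x => ∏ i, f i (x i) := by
  refine Measure.pi_eq fun s hs => ?_
  rw [withDensity_apply _ (MeasurableSet.univ_pi hs),
    ← lintegral_indicator (MeasurableSet.univ_pi hs)]
  have hind : ∀ x : ∀ i, α i, (Set.univ.pi s).indicator (fun x => ∏ i, f i (x i)) x =
      ∏ i, (s i).indicator (f i) (x i) := by
    intro x
    by_cases hx : x ∈ Set.univ.pi s
    · rw [Set.indicator_of_mem hx]
      exact Finset.prod_congr rfl fun i _ => (Set.indicator_of_mem (hx i trivial) _).symm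
    · rw [Set.indicator_of_notMem hx]
      simp only [Set.mem_pi, Set.mem_univ, true_imp_iff, not_forall] at hx
      obtain ⟨i, hi⟩ := hx
      exact (Finset.prod_eq_zero (Finset.mem_univ i) (Set.indicator_of_notMem hi _)).symm
  have hmeas : ∀ i, Measurable ((s i).indicator (f i)) := fun i => (hf i).indicator (hs i)
  have hmp := fun i => measurePreserving_eval μ i
  simp_rw [hind]
  rw [lintegral_prod_eq_prod_lintegral_of_indepFun Finset.univ
    (fun i (x : ∀ i, α i) => (s i).indicator (f i) (x i))
    (iIndepFun_pi fun i => (hmeas i).aemeasurable)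
    (fun i => (hmeas i).comp (measurable_pi_apply i))]
  refine Finset.prod_congr rfl fun i _ => ?_
  rw [(hmp i).lintegral_comp (hmeas i), lintegral_indicator (hs i), withDensity_apply _ (hs i)]

/-- A unit-variance Gaussian law is a density against the standard one. -/
theorem gaussianReal_eq_withDensity (m : ℝ) :
    gaussianReal m 1 = (gaussianReal 0 1).withDensity
      fun x => ENNReal.ofReal (Real.exp (m * x - m ^ 2 / 2)) := by
  rw [gaussianReal_of_var_ne_zero _ one_ne_zero, gaussianReal_of_var_ne_zero _ one_ne_zero,
    ← withDensity_mul _ (measurable_gaussianPDF _ _) (by fun_prop)]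
  congr 1
  ext x
  rw [Pi.mul_apply, gaussianPDF, gaussianPDF,
    ← ENNReal.ofReal_mul (gaussianPDFReal_nonneg _ _ _), gaussianPDFReal, gaussianPDFReal,
    mul_assoc _ (Real.exp _), ← Real.exp_add]
  congr 4
  simp
  ring

theorem hasSubgaussianMGF_gaussianReal :
    HasSubgaussianMGF (fun x => x) 1 (gaussianReal 0 1) where
  integrable_exp_mul t := integrable_exp_mul_gaussianReal t
  mgf_le t := by simp [mgf_fun_id_gaussianReal]

/-- With `q = exp (l/2)`, two uses of `1 + y ≤ exp y` show that the bracket is at least `(q - 1)²`.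
Then `|q² - 1| = |q - 1| (q + 1) ≤ 10 (q - 1)² + (q + 1)²/40` by AM-GM, and `(q + 1)² ≤ 2 (q² + 1)`.
-/
theorem abs_exp_sub_one_le (l v : ℝ) :
    |Real.exp l - 1| ≤ 10 * (Real.exp l - 3 + 3 / 4 * v + 2 * Real.exp (-(l / 2) - 3 / 8 * v)) +
      (Real.exp l + 1) / 20 := by
  have h1 := Real.add_one_le_exp (l / 2)
  have h2 := Real.add_one_le_exp (-(l / 2) - 3 / 8 * v)
  have h3 : Real.exp l = Real.exp (l / 2) ^ 2 := by
    rw [← Real.exp_nat_mul]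
    congr 1
    push_cast
    ring
  set q := Real.exp (l / 2)
  rw [h3, abs_le]
  constructor <;> nlinarith [sq_nonneg (20 * (q - 1) + (q + 1)), sq_nonneg (20 * (q - 1) - (q + 1)),
    sq_nonneg (q - 1)]

namespace FedBandit

/-! ### Likelihood ratio and information of a history -/

/-- The environment with a given preference vector and standard Gaussian noise. -/
def gaussianEnv {d : ℕ} (θ : EuclideanSpace ℝ (Fin d)) (hθ : ‖θ‖ ≤ 1) : Environment d where
  θ := θ
  norm_le := hθ
  armNoise := gaussianReal 0 1
  keyNoise := gaussianReal 0 1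
  armNoise_prob := inferInstance
  keyNoise_prob := inferInstance
  armNoise_subgaussian := hasSubgaussianMGF_gaussianReal
  keyNoise_subgaussian := hasSubgaussianMGF_gaussianReal

variable {d M K : ℕ} (S : Setting d M K) (π : Policy S)

/-- The feature vector of a chosen key term, which is `0` if none is chosen. -/
def keyVec : Option (Fin S.numKeys) → EuclideanSpace ℝ (Fin d)
  | none => 0
  | some j => S.key j

theorem norm_keyVec_le (o : Option (Fin S.numKeys)) : ‖keyVec S o‖ ≤ 1 := by
  cases o with
  | none => simp [keyVec]
  | some j => simp [keyVec, S.key_norm j]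

/-- The log-likelihood ratio of one time step, for the preference vector `θ` against `0`. -/
def roundLogLik (θ : EuclideanSpace ℝ (Fin d)) (r : Round M K S.numKeys) : ℝ :=
  ∑ i, ((inner ℝ (S.arm i (r.1 i).1) θ * (r.2 i).1 - inner ℝ (S.arm i (r.1 i).1) θ ^ 2 / 2) +
    (inner ℝ (keyVec S (r.1 i).2) θ * (r.2 i).2 - inner ℝ (keyVec S (r.1 i).2) θ ^ 2 / 2))

/-- The log-likelihood ratio of a history, for the preference vector `θ` against `0`. -/
def logLik (θ : EuclideanSpace ℝ (Fin d)) {n : ℕ} (h : History M K S.numKeys n) : ℝ :=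
  ∑ t, roundLogLik S θ (h t)

/-- The information on `θ` in a history: the sum of the squared means of all observations. -/
def info (θ : EuclideanSpace ℝ (Fin d)) {n : ℕ} (h : History M K S.numKeys n) : ℝ :=
  ∑ t, ∑ i, (inner ℝ (S.arm i ((h t).1 i).1) θ ^ 2 + inner ℝ (keyVec S ((h t).1 i).2) θ ^ 2)

theorem measurable_roundLogLik (θ : EuclideanSpace ℝ (Fin d)) :
    Measurable (roundLogLik S θ) := by
  unfold roundLogLik
  have h1 : ∀ i, Measurable fun r : Round M K S.numKeys =>
      (inner ℝ (S.arm i (r.1 i).1) θ : ℝ) := fun i =>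
    (Measurable.of_discrete (f := fun a : Action M K S.numKeys =>
      (inner ℝ (S.arm i (a i).1) θ : ℝ))).comp measurable_fst
  have h2 : ∀ i, Measurable fun r : Round M K S.numKeys =>
      (inner ℝ (keyVec S (r.1 i).2) θ : ℝ) := fun i =>
    (Measurable.of_discrete (f := fun a : Action M K S.numKeys =>
      (inner ℝ (keyVec S (a i).2) θ : ℝ))).comp measurable_fst
  refine Finset.measurable_sum _ fun i _ => ?_
  have := h1 i
  have := h2 i
  fun_prop

theorem measurable_logLik (θ : EuclideanSpace ℝ (Fin d)) (n : ℕ) :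
    Measurable (logLik S θ : History M K S.numKeys n → ℝ) :=
  Finset.measurable_sum _ fun t _ => (measurable_roundLogLik S θ).comp (measurable_pi_apply t)

theorem measurable_comp_action {n : ℕ} (t : Fin n) (f : Action M K S.numKeys → ℝ) :
    Measurable fun h : History M K S.numKeys n => f (h t).1 :=
  (Measurable.of_discrete (f := f)).comp (measurable_fst.comp (measurable_pi_apply t))

theorem measurable_info (θ : EuclideanSpace ℝ (Fin d)) (n : ℕ) :
    Measurable (info S θ : History M K S.numKeys n → ℝ) :=
  Finset.measurable_sum _ fun t _ => measurable_comp_action S t fun a =>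
    ∑ i, (inner ℝ (S.arm i (a i).1) θ ^ 2 + inner ℝ (keyVec S (a i).2) θ ^ 2)

/-! ### Change of measure -/

section Likelihood

variable (θ : EuclideanSpace ℝ (Fin d)) (hθ : ‖θ‖ ≤ 1)

/-- The environment with preference vector `0` and standard Gaussian noise. -/
abbrev nullEnv (d : ℕ) : Environment d := gaussianEnv 0 (by simp)

theorem armLaw_gaussianEnv (i : Fin M) (k : Fin K) :
    armLaw S (gaussianEnv θ hθ) i k = gaussianReal (inner ℝ (S.arm i k) θ) 1 := by
  unfold armLaw
  simpa [gaussianEnv] using gaussianReal_map_const_add (μ := 0) (v := 1) (inner ℝ (S.arm i k) θ)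

theorem keyLaw_gaussianEnv_some (j : Fin S.numKeys) :
    keyLaw S (gaussianEnv θ hθ) (some j) = gaussianReal (inner ℝ (S.key j) θ) 1 := by
  unfold keyLaw
  simpa [gaussianEnv] using gaussianReal_map_const_add (μ := 0) (v := 1) (inner ℝ (S.key j) θ)

theorem armLaw_eq_withDensity (i : Fin M) (k : Fin K) :
    armLaw S (gaussianEnv θ hθ) i k = (armLaw S (nullEnv d) i k).withDensity fun x =>
      ENNReal.ofReal (Real.exp (inner ℝ (S.arm i k) θ * x - inner ℝ (S.arm i k) θ ^ 2 / 2)) := by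
  rw [armLaw_gaussianEnv, armLaw_gaussianEnv, gaussianReal_eq_withDensity, inner_zero_right]

theorem keyLaw_eq_withDensity (o : Option (Fin S.numKeys)) :
    keyLaw S (gaussianEnv θ hθ) o = (keyLaw S (nullEnv d) o).withDensity fun x =>
      ENNReal.ofReal (Real.exp (inner ℝ (keyVec S o) θ * x - inner ℝ (keyVec S o) θ ^ 2 / 2)) := by
  cases o with
  -- With `keyVec = 0` the density is `1`, and both laws are the point mass at `0`.
  | none => simp [keyLaw, keyVec]
  | some j =>
    rw [keyLaw_gaussianEnv_some, keyLaw_gaussianEnv_some, gaussianReal_eq_withDensity,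
      inner_zero_right]
    rfl

theorem feedback_eq_withDensity (a : Action M K S.numKeys) :
    feedback S (gaussianEnv θ hθ) a = (feedback S (nullEnv d) a).withDensity fun x =>
      ENNReal.ofReal (Real.exp (roundLogLik S θ (a, x))) := by
  change feedbackLaw S _ a = (feedbackLaw S _ a).withDensity _
  unfold feedbackLaw
  have hprod : ∀ i, (armLaw S (gaussianEnv θ hθ) i (a i).1).prod
      (keyLaw S (gaussianEnv θ hθ) (a i).2) =
      ((armLaw S (nullEnv d) i (a i).1).prod (keyLaw S (nullEnv d) (a i).2)).withDensity
        fun z : ℝ × ℝ =>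
          ENNReal.ofReal (Real.exp (inner ℝ (S.arm i (a i).1) θ * z.1
            - inner ℝ (S.arm i (a i).1) θ ^ 2 / 2)) *
          ENNReal.ofReal (Real.exp (inner ℝ (keyVec S (a i).2) θ * z.2
            - inner ℝ (keyVec S (a i).2) θ ^ 2 / 2)) := by
    intro i
    rw [armLaw_eq_withDensity, keyLaw_eq_withDensity,
      prod_withDensity (by fun_prop) (by fun_prop)]
  have : ∀ i, SigmaFinite (((armLaw S (nullEnv d) i (a i).1).prod
      (keyLaw S (nullEnv d) (a i).2)).withDensity
        fun z : ℝ × ℝ =>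
          ENNReal.ofReal (Real.exp (inner ℝ (S.arm i (a i).1) θ * z.1
            - inner ℝ (S.arm i (a i).1) θ ^ 2 / 2)) *
          ENNReal.ofReal (Real.exp (inner ℝ (keyVec S (a i).2) θ * z.2
            - inner ℝ (keyVec S (a i).2) θ ^ 2 / 2))) := by
    intro i
    rw [← hprod i]
    infer_instance
  simp_rw [hprod]
  rw [pi_withDensity _ _ (fun i => by fun_prop)]
  congr 1
  ext x
  rw [roundLogLik, Real.exp_sum, ENNReal.ofReal_prod_of_nonneg fun i _ => (Real.exp_pos _).le]
  refine Finset.prod_congr rfl fun i _ => ?_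
  rw [Real.exp_add, ENNReal.ofReal_mul (Real.exp_pos _).le]

theorem logLik_snoc {n : ℕ} (h : History M K S.numKeys n) (r : Round M K S.numKeys) :
    logLik S θ (Fin.snoc (α := fun _ => Round M K S.numKeys) h r : History M K S.numKeys (n + 1)) =
      logLik S θ h + roundLogLik S θ r := by
  simp [logLik, Fin.sum_univ_castSucc]

theorem lintegral_step (E : Environment d) (n : ℕ) (h : History M K S.numKeys n)
    {f : Round M K S.numKeys → ENNReal} (hf : Measurable f) :
    ∫⁻ r, f r ∂step S E π n h = ∫⁻ a, ∫⁻ x, f (a, x) ∂feedback S E a ∂π.act n h := by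
  have := π.act_markov n
  rw [step, Kernel.lintegral_compProd _ _ _ hf]
  rfl

theorem lintegral_law_succ (E : Environment d) (n : ℕ)
    {f : History M K S.numKeys (n + 1) → ENNReal} (hf : Measurable f) :
    ∫⁻ h, f h ∂law S E π (n + 1) = ∫⁻ h, ∫⁻ a, ∫⁻ x,
      f (Fin.snoc (α := fun _ => Round M K S.numKeys) h (a, x))
        ∂feedback S E a ∂π.act n h ∂law S E π n := by
  have hfs : Measurable fun p : History M K S.numKeys n × Round M K S.numKeys =>
      f (Fin.snoc (α := fun _ => Round M K S.numKeys) p.1 p.2) :=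
    hf.comp (measurable_snoc M K S.numKeys n)
  rw [law, lintegral_map hf (measurable_snoc M K S.numKeys n), Measure.lintegral_compProd hfs]
  exact lintegral_congr fun h => lintegral_step S π E n h (hfs.comp measurable_prodMk_left)

/-- Change of measure from the preference vector `0` to `θ`. -/
theorem lintegral_law_gaussianEnv (n : ℕ) :
    ∀ {f : History M K S.numKeys n → ENNReal}, Measurable f →
      ∫⁻ h, f h ∂law S (gaussianEnv θ hθ) π n =
        ∫⁻ h, ENNReal.ofReal (Real.exp (logLik S θ h)) * f h ∂law S (nullEnv d) π n := by
  induction n with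
  | zero => intro f hf; simp [law, logLik]
  | succ n ih =>
    intro f hf
    have := π.act_markov n
    have hs := measurable_snoc M K S.numKeys n
    have hr := measurable_roundLogLik S θ
    have hg : Measurable fun h => ENNReal.ofReal (Real.exp (logLik S θ h)) * f h :=
      (measurable_logLik S θ (n + 1)).exp.ennreal_ofReal.mul hf
    rw [lintegral_law_succ S π _ n hf, lintegral_law_succ S π _ n hg, ih]
    · refine lintegral_congr fun h => ?_
      have hin : ∀ a : Action M K S.numKeys, Measurable fun x : Feedback M =>
          ENNReal.ofReal (Real.exp (roundLogLik S θ (a, x))) := fun a =>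
        (hr.comp measurable_prodMk_left).exp.ennreal_ofReal
      have hfa : ∀ a : Action M K S.numKeys, Measurable fun x : Feedback M =>
          f (Fin.snoc (α := fun _ => Round M K S.numKeys) h (a, x)) := fun a =>
        (hf.comp hs).comp (measurable_prodMk_left.comp measurable_prodMk_left)
      rw [← lintegral_const_mul _ Measurable.of_discrete]
      refine lintegral_congr fun a => ?_
      -- The policy's kernel is the same in both environments; only the feedback contributes a
      -- density.
      rw [feedback_eq_withDensity, lintegral_withDensity_eq_lintegral_mul _ (hin a) (hfa a),
        ← lintegral_const_mul _ ((hin a).mul (hfa a))]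
      refine lintegral_congr fun x => ?_
      rw [logLik_snoc, Real.exp_add, ENNReal.ofReal_mul (Real.exp_pos _).le, Pi.mul_apply,
        mul_assoc]
    · have h1 : Measurable fun p : History M K S.numKeys n × Round M K S.numKeys =>
          f (Fin.snoc (α := fun _ => Round M K S.numKeys) p.1 p.2) := hf.comp hs
      -- Measurability of the iterated integral is read off from the single kernel `step`.
      have h2 : Measurable fun h => ∫⁻ r, f (Fin.snoc (α := fun _ => Round M K S.numKeys) h r)
          ∂step S (gaussianEnv θ hθ) π n h := h1.lintegral_kernel_prod_right'
      convert h2 using 2 with h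
      exact (lintegral_step S π _ n h (h1.comp measurable_prodMk_left)).symm

theorem law_gaussianEnv_eq_withDensity (n : ℕ) :
    law S (gaussianEnv θ hθ) π n = (law S (nullEnv d) π n).withDensity
      fun h => ENNReal.ofReal (Real.exp (logLik S θ h)) := by
  ext s hs
  rw [withDensity_apply _ hs, ← lintegral_indicator_one hs,
    lintegral_law_gaussianEnv S π θ hθ n (measurable_one.indicator hs), ← lintegral_indicator hs]
  refine lintegral_congr fun h => ?_
  by_cases hh : h ∈ s <;> simp [hh]

theorem integral_law_gaussianEnv (n : ℕ) (f : History M K S.numKeys n → ℝ) :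
    ∫ h, f h ∂law S (gaussianEnv θ hθ) π n =
      ∫ h, Real.exp (logLik S θ h) * f h ∂law S (nullEnv d) π n := by
  rw [law_gaussianEnv_eq_withDensity, integral_withDensity_eq_integral_toReal_smul
    (measurable_logLik S θ n).exp.ennreal_ofReal (by simp)]
  simp [ENNReal.toReal_ofReal (Real.exp_pos _).le]

theorem integrable_law_gaussianEnv_iff (n : ℕ) (f : History M K S.numKeys n → ℝ) :
    Integrable f (law S (gaussianEnv θ hθ) π n) ↔
      Integrable (fun h => Real.exp (logLik S θ h) * f h) (law S (nullEnv d) π n) := by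
  rw [law_gaussianEnv_eq_withDensity, integrable_withDensity_iff_integrable_smul'
    (measurable_logLik S θ n).exp.ennreal_ofReal (by simp)]
  simp [ENNReal.toReal_ofReal (Real.exp_pos _).le]

theorem integrable_exp_logLik {θ : EuclideanSpace ℝ (Fin d)} (hθ : ‖θ‖ ≤ 1) (n : ℕ) :
    Integrable (fun h => Real.exp (logLik S θ h)) (law S (nullEnv d) π n) := by
  simpa using (integrable_law_gaussianEnv_iff S π θ hθ n fun _ => 1).1 (integrable_const 1)

theorem integral_exp_logLik {θ : EuclideanSpace ℝ (Fin d)} (hθ : ‖θ‖ ≤ 1) (n : ℕ) :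
    ∫ h, Real.exp (logLik S θ h) ∂law S (nullEnv d) π n = 1 := by
  simpa using (integral_law_gaussianEnv S π θ hθ n fun _ => 1).symm

end Likelihood

/-! ### Comparing means under `θ` and under `0` -/

theorem logLik_neg_half_smul (θ : EuclideanSpace ℝ (Fin d)) {n : ℕ}
    (h : History M K S.numKeys n) :
    logLik S ((-(1 / 2) : ℝ) • θ) h = -(logLik S θ h / 2) - 3 / 8 * info S θ h := by
  simp only [logLik, info, roundLogLik, inner_smul_right, Finset.sum_div, Finset.mul_sum,
    ← Finset.sum_neg_distrib, ← Finset.sum_sub_distrib]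
  refine Finset.sum_congr rfl fun t _ => Finset.sum_congr rfl fun i _ => ?_
  -- For an observation `x` with mean `m`: `-mx/2 - m²/8 = -(mx - m²/2)/2 - 3m²/8`.
  ring

theorem inner_sq_le {x θ : EuclideanSpace ℝ (Fin d)} (hx : ‖x‖ ≤ 1) (hθ : ‖θ‖ ≤ 1) :
    inner ℝ x θ ^ 2 ≤ 1 := by
  have h := abs_real_inner_le_norm x θ
  have h' : ‖x‖ * ‖θ‖ ≤ 1 := mul_le_one₀ hx (norm_nonneg _) hθ
  rw [sq_le_one_iff_abs_le_one]
  linarith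

theorem info_nonneg (θ : EuclideanSpace ℝ (Fin d)) {n : ℕ} (h : History M K S.numKeys n) :
    0 ≤ info S θ h := by
  unfold info
  positivity

theorem info_le {θ : EuclideanSpace ℝ (Fin d)} (hθ : ‖θ‖ ≤ 1) {n : ℕ}
    (h : History M K S.numKeys n) : info S θ h ≤ ∑ _t : Fin n, ∑ _i : Fin M, (1 + 1) :=
  Finset.sum_le_sum fun _ _ => Finset.sum_le_sum fun _ _ =>
    add_le_add (inner_sq_le (S.arm_norm _ _).le hθ) (inner_sq_le (norm_keyVec_le S _) hθ)

theorem integrable_info {θ : EuclideanSpace ℝ (Fin d)} (hθ : ‖θ‖ ≤ 1) (n : ℕ) (E : Environment d) :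
    Integrable (fun h => info S θ h) (law S E π n) :=
  Integrable.of_bound (measurable_info S θ n).aestronglyMeasurable _
    (Filter.Eventually.of_forall fun h => by
      rw [Real.norm_of_nonneg (info_nonneg S θ h)]
      exact info_le S hθ h)

/-- A bounded statistic has similar means under `θ` and under `0` if the information on `θ` is
small. -/
theorem integral_law_gaussianEnv_le {θ : EuclideanSpace ℝ (Fin d)} (hθ : ‖θ‖ ≤ 1) (n : ℕ)
    {G : History M K S.numKeys n → ℝ} (hG : Measurable G) {B : ℝ} (hB : ∀ h, |G h| ≤ B) :
    ∫ h, G h ∂law S (gaussianEnv θ hθ) π n ≤ ∫ h, G h ∂law S (nullEnv d) π n +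
      B * (15 / 2 * ∫ h, info S θ h ∂law S (nullEnv d) π n + 1 / 10) := by
  -- `-θ/2` is itself an admissible preference vector, so its likelihood ratio also has null mean
  -- `1`.
  have hθ' : ‖(-(1 / 2) : ℝ) • θ‖ ≤ 1 := by
    rw [norm_smul]
    norm_num
    linarith [norm_nonneg θ]
  have hGi : ∀ E : Environment d, Integrable G (law S E π n) := fun E =>
    Integrable.of_bound hG.aestronglyMeasurable B (Filter.Eventually.of_forall hB)
  have iL := integrable_exp_logLik S π hθ n
  have iR := integrable_exp_logLik S π hθ' n
  have iV := integrable_info S π hθ n (nullEnv d)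
  have i0 : Integrable (fun h => Real.exp (logLik S θ h) - 3) (law S (nullEnv d) π n) :=
    iL.sub (integrable_const 3)
  have i1 : Integrable (fun h => Real.exp (logLik S θ h) - 3 + 3 / 4 * info S θ h)
      (law S (nullEnv d) π n) := i0.add (iV.const_mul _)
  have i2 : Integrable (fun h => 2 * Real.exp (logLik S ((-(1 / 2) : ℝ) • θ) h))
      (law S (nullEnv d) π n) := iR.const_mul _
  have i3 : Integrable (fun h => 10 * (Real.exp (logLik S θ h) - 3 + 3 / 4 * info S θ h +
      2 * Real.exp (logLik S ((-(1 / 2) : ℝ) • θ) h))) (law S (nullEnv d) π n) :=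
    (i1.add i2).const_mul _
  have i4 : Integrable (fun h => (Real.exp (logLik S θ h) + 1) / 20) (law S (nullEnv d) π n) :=
    (iL.add (integrable_const 1)).div_const _
  have i5 : Integrable (fun h => B * (10 * (Real.exp (logLik S θ h) - 3 + 3 / 4 * info S θ h +
      2 * Real.exp (logLik S ((-(1 / 2) : ℝ) • θ) h)) + (Real.exp (logLik S θ h) + 1) / 20))
      (law S (nullEnv d) π n) := (i3.add i4).const_mul B
  rw [integral_law_gaussianEnv]
  calc
    _ ≤ ∫ h, (G h + B * (10 * (Real.exp (logLik S θ h) - 3 + 3 / 4 * info S θ h +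
          2 * Real.exp (logLik S ((-(1 / 2) : ℝ) • θ) h)) + (Real.exp (logLik S θ h) + 1) / 20))
          ∂law S (nullEnv d) π n := by
      refine integral_mono ((integrable_law_gaussianEnv_iff S π θ hθ n G).1 (hGi _))
        ((hGi _).add i5) fun h => ?_
      have h1 := abs_exp_sub_one_le (logLik S θ h) (info S θ h)
      have h2 : (Real.exp (logLik S θ h) - 1) * G h ≤ B * |Real.exp (logLik S θ h) - 1| := by
        calc
          _ ≤ |(Real.exp (logLik S θ h) - 1) * G h| := le_abs_self _
          _ = |G h| * |Real.exp (logLik S θ h) - 1| := by rw [abs_mul, mul_comm]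
          _ ≤ _ := mul_le_mul_of_nonneg_right (hB h) (abs_nonneg _)
      have h3 := mul_le_mul_of_nonneg_left h1 ((abs_nonneg _).trans (hB h))
      simp only [logLik_neg_half_smul]
      linarith
    _ = _ := by
      -- The bracket has null mean `1 - 3 + (3/4) E[info] + 2 = (3/4) E[info]`, and the last term
      -- has mean `2/20`.
      rw [integral_add (hGi _) i5, integral_const_mul, integral_add i3 i4,
        integral_const_mul, integral_add i1 i2, integral_add i0 (iV.const_mul _), integral_sub iL (integrable_const 3), integral_const_mul,
        integral_const_mul, integral_div, integral_add iL (integrable_const 1),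
        integral_exp_logLik S π hθ, integral_exp_logLik S π hθ']
      simp only [integral_const, probReal_univ, one_smul]
      ring

/-! ### Averaging over the coordinate directions -/

/-- The sum of the `j`-th coordinates of the chosen arms. -/
def coordSum (j : Fin d) {n : ℕ} (h : History M K S.numKeys n) : ℝ :=
  ∑ t, ∑ i, S.arm i ((h t).1 i).1 j

theorem measurable_coordSum (j : Fin d) (n : ℕ) :
    Measurable (coordSum S j : History M K S.numKeys n → ℝ) :=
  Finset.measurable_sum _ fun t _ => measurable_comp_action S t fun a => ∑ i, S.arm i (a i).1 j

theorem abs_coordSum_le (j : Fin d) {n : ℕ} (h : History M K S.numKeys n) :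
    |coordSum S j h| ≤ M * n := by
  calc
    _ ≤ ∑ t : Fin n, ∑ i : Fin M, |S.arm i ((h t).1 i).1 j| :=
      (Finset.abs_sum_le_sum_abs _ _).trans
        (Finset.sum_le_sum fun _ _ => Finset.abs_sum_le_sum_abs _ _)
    _ ≤ ∑ t : Fin n, ∑ i : Fin M, (1 : ℝ) :=
      Finset.sum_le_sum fun t _ => Finset.sum_le_sum fun i _ => by
        have := PiLp.norm_apply_le (S.arm i ((h t).1 i).1) j
        rwa [S.arm_norm, Real.norm_eq_abs] at this
    _ = _ := by simp [mul_comm]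

theorem integrable_coordSum (j : Fin d) (n : ℕ) (E : Environment d) :
    Integrable (fun h => coordSum S j h) (law S E π n) :=
  Integrable.of_bound (measurable_coordSum S j n).aestronglyMeasurable (M * n)
    (Filter.Eventually.of_forall fun h => abs_coordSum_le S j h)

/-- A linear substitute for `√d`: the tangent bound `x ≤ (3/4) x² + 1/3`, tight at `x = 2/3`, gives
`3/4 + d/3`, which is at most `17d/24` exactly when `d ≥ 2`. -/
theorem sum_coord_le {x : EuclideanSpace ℝ (Fin d)} (hx : ‖x‖ = 1) (hd : 2 ≤ d) :
    ∑ j, x j ≤ 17 / 24 * d := by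
  have h1 : ∑ j, x j ^ 2 = 1 := by
    rw [← EuclideanSpace.real_norm_sq_eq, hx, one_pow]
  have h2 : ∑ j, x j ≤ ∑ j : Fin d, (3 / 4 * x j ^ 2 + 1 / 3) :=
    Finset.sum_le_sum fun j _ => by nlinarith [sq_nonneg (x j - 2 / 3)]
  rw [Finset.sum_add_distrib, ← Finset.mul_sum, h1] at h2
  simp only [Finset.sum_const, Finset.card_univ, Fintype.card_fin, nsmul_eq_mul] at h2
  have : (2 : ℝ) ≤ d := by exact_mod_cast hd
  linarith

theorem sum_coordSum_le (hd : 2 ≤ d) {n : ℕ} (h : History M K S.numKeys n) :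
    ∑ j, coordSum S j h ≤ 17 / 24 * d * (M * n) := by
  unfold coordSum
  rw [Finset.sum_comm]
  simp_rw [Finset.sum_comm (s := (Finset.univ : Finset (Fin d)))]
  calc
    _ ≤ ∑ t : Fin n, ∑ i : Fin M, (17 / 24 * d : ℝ) :=
      Finset.sum_le_sum fun t _ => Finset.sum_le_sum fun i _ => sum_coord_le (S.arm_norm _ _) hd
    _ = _ := by simp; ring

theorem inner_smul_single (x : EuclideanSpace ℝ (Fin d)) (Δ : ℝ) (j : Fin d) :
    inner ℝ x (Δ • EuclideanSpace.single j (1 : ℝ)) = Δ * x j := by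
  simp [inner_smul_right, EuclideanSpace.inner_single_right]

/-- Summing squared coordinates over `j` gives a squared norm, at most `1` for the arm and at most
`1` for the key term; hence the factor `2`. -/
theorem sum_info_le (Δ : ℝ) {n : ℕ} (h : History M K S.numKeys n) :
    ∑ j, info S (Δ • EuclideanSpace.single j (1 : ℝ)) h ≤ 2 * (Δ ^ 2 * (M * n)) := by
  have hx : ∀ x : EuclideanSpace ℝ (Fin d), ‖x‖ ≤ 1 → ∑ j, x j ^ 2 ≤ 1 := fun x hx => by
    rw [← EuclideanSpace.real_norm_sq_eq]
    exact pow_le_one₀ (norm_nonneg _) hx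
  unfold info
  rw [Finset.sum_comm]
  simp_rw [Finset.sum_comm (s := (Finset.univ : Finset (Fin d)))]
  calc
    _ ≤ ∑ t : Fin n, ∑ i : Fin M, (Δ ^ 2 * 1 + Δ ^ 2 * 1) := by
      refine Finset.sum_le_sum fun t _ => Finset.sum_le_sum fun i _ => ?_
      simp_rw [inner_smul_single, mul_pow, Finset.sum_add_distrib, ← Finset.mul_sum]
      exact add_le_add (mul_le_mul_of_nonneg_left (hx _ (S.arm_norm _ _).le) (sq_nonneg _))
        (mul_le_mul_of_nonneg_left (hx _ (norm_keyVec_le S _)) (sq_nonneg _))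
    _ = _ := by simp; ring

theorem norm_smul_single_le {Δ : ℝ} (h0 : 0 ≤ Δ) (h1 : Δ ≤ 1) (j : Fin d) :
    ‖Δ • EuclideanSpace.single j (1 : ℝ)‖ ≤ 1 := by
  simpa [norm_smul, abs_of_nonneg h0] using h1

theorem iSup_inner_smul_single {Δ : ℝ} (h0 : 0 ≤ Δ) (i : Fin M) (j : Fin d)
    (hj : EuclideanSpace.single j (1 : ℝ) ∈ Set.range (S.arm i)) :
    ⨆ k, inner ℝ (S.arm i k) (Δ • EuclideanSpace.single j (1 : ℝ)) = Δ := by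
  obtain ⟨k, hk⟩ := hj
  have : Nonempty (Fin K) := ⟨k⟩
  refine le_antisymm (ciSup_le fun l => ?_) ?_
  · have h := real_inner_le_norm (S.arm i l) (Δ • EuclideanSpace.single j (1 : ℝ))
    simpa [S.arm_norm, norm_smul, abs_of_nonneg h0] using h
  · refine le_trans (le_of_eq ?_) (le_ciSup (Set.finite_range _).bddAbove k)
    rw [inner_smul_single, hk]
    simp

theorem expectedRegret_gaussianEnv {Δ : ℝ} (h0 : 0 ≤ Δ) (h1 : Δ ≤ 1) (j : Fin d)
    (hj : ∀ i, EuclideanSpace.single j (1 : ℝ) ∈ Set.range (S.arm i)) (T : ℕ) :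
    expectedRegret S (gaussianEnv _ (norm_smul_single_le h0 h1 j)) π T =
      Δ * (M * T - ∫ h, coordSum S j h
        ∂law S (gaussianEnv _ (norm_smul_single_le h0 h1 j)) π T) := by
  have hreg : ∀ h : History M K S.numKeys T,
      regret S (gaussianEnv _ (norm_smul_single_le h0 h1 j)) h =
        Δ * (M * T - coordSum S j h) := by
    intro h
    unfold regret coordSum
    rw [Finset.sum_comm]
    simp only [gaussianEnv]
    simp_rw [iSup_inner_smul_single S h0 _ j (hj _), inner_smul_single, Finset.sum_sub_distrib,
      ← Finset.mul_sum]
    simp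
    ring
  unfold expectedRegret
  simp_rw [hreg]
  rw [integral_const_mul, integral_sub (integrable_const _) (integrable_coordSum S π j T _)]
  simp

/-- If every client has all standard basis vectors among its arms, then some scaled standard basis
vector is a preference vector with large regret. -/
theorem exists_le_expectedRegret (hd : 2 ≤ d)
    (hS : ∀ i j, EuclideanSpace.single j (1 : ℝ) ∈ Set.range (S.arm i)) (T : ℕ) {Δ : ℝ}
    (h0 : 0 ≤ Δ) (h1 : Δ ≤ 1) (hΔ : Δ ^ 2 * (M * T) ≤ d / 400) :
    ∃ j, 7 / 50 * (Δ * (M * T)) ≤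
      expectedRegret S (gaussianEnv _ (norm_smul_single_le h0 h1 j)) π T := by
  have hd' : (2 : ℝ) ≤ d := by exact_mod_cast hd
  have : NeZero d := ⟨by omega⟩
  have hG : ∑ j, ∫ h, coordSum S j h ∂law S (nullEnv d) π T ≤ 17 / 24 * d * (M * T) := by
    rw [← integral_finsetSum _ fun j _ => integrable_coordSum S π j T _]
    refine (integral_mono (integrable_finsetSum _ fun j _ => integrable_coordSum S π j T _)
      (integrable_const _) fun h => sum_coordSum_le S hd h).trans ?_
    simp
  have hV : ∑ j, ∫ h, info S (Δ • EuclideanSpace.single j (1 : ℝ)) h ∂law S (nullEnv d) π T ≤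
      2 * (Δ ^ 2 * (M * T)) := by
    have hi := fun j : Fin d => integrable_info S π (norm_smul_single_le h0 h1 j) T (nullEnv d)
    rw [← integral_finsetSum _ fun j _ => hi j]
    refine (integral_mono (integrable_finsetSum _ fun j _ => hi j)
      (integrable_const _) fun h => sum_info_le S Δ h).trans ?_
    simp
  have hsum : ∑ j, ∫ h, coordSum S j h ∂law S (gaussianEnv _ (norm_smul_single_le h0 h1 j)) π T ≤
      ∑ _j : Fin d, 43 / 50 * ((M : ℝ) * T) := by
    refine (Finset.sum_le_sum fun j _ => integral_law_gaussianEnv_le S π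
      (norm_smul_single_le h0 h1 j) T (measurable_coordSum S j T)
      (fun h => abs_coordSum_le S j h)).trans ?_
    rw [Finset.sum_add_distrib, ← Finset.mul_sum, Finset.sum_add_distrib, ← Finset.mul_sum]
    simp only [Finset.sum_const, Finset.card_univ, Fintype.card_fin, nsmul_eq_mul]
    have hMT : (0 : ℝ) ≤ M * T := by positivity
    have := mul_le_mul_of_nonneg_left (hV.trans (mul_le_mul_of_nonneg_left hΔ zero_le_two)) hMT
    have := mul_nonneg (a := (d : ℝ)) (by positivity) hMT
    -- `17/24 + (15/2) · (2/400) + 1/10 < 43/50`.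
    linarith
  obtain ⟨j, -, hj⟩ := Finset.exists_le_of_sum_le Finset.univ_nonempty hsum
  refine ⟨j, ?_⟩
  rw [expectedRegret_gaussianEnv S π h0 h1 j fun i => hS i j]
  have := mul_le_mul_of_nonneg_left hj h0
  linarith

/-! ### Arms and rich key terms -/

/-- There is a finite set of unit vectors that is rich with any given constant below `1`. -/
theorem exists_finite_rich (d : ℕ) {C : ℝ} (hC : C < 1) :
    ∃ s : Finset (EuclideanSpace ℝ (Fin d)), (∀ x ∈ s, ‖x‖ = 1) ∧
      ∀ v : EuclideanSpace ℝ (Fin d), ‖v‖ = 1 → ∃ x ∈ s, C ≤ inner ℝ x v := by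
  obtain ⟨s, hs, hcov⟩ := (isCompact_sphere (0 : EuclideanSpace ℝ (Fin d)) 1).elim_nhds_subcover
    -- Open caps that contain their centres because `C < 1`; compactness of the sphere leaves
    -- finitely many.
    (fun x => {v | C < inner ℝ x v}) fun x hx => by
      refine (isOpen_lt continuous_const (by fun_prop)).mem_nhds ?_
      rw [mem_sphere_zero_iff_norm] at hx
      simpa [real_inner_self_eq_norm_sq, hx] using hC
  refine ⟨s, fun x hx => mem_sphere_zero_iff_norm.1 (hs x hx), fun v hv => ?_⟩
  obtain ⟨x, hx, hxv⟩ := Set.mem_iUnion₂.1 (hcov (mem_sphere_zero_iff_norm.2 hv))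
  exact ⟨x, hx, le_of_lt hxv⟩

/-- There are `K ≥ d` distinct unit vectors that include the standard basis. -/
theorem exists_arms {d K : ℕ} (hd : 2 ≤ d) (hK : d ≤ K) :
    ∃ f : Fin K → EuclideanSpace ℝ (Fin d), Function.Injective f ∧ (∀ k, ‖f k‖ = 1) ∧
      ∀ j, EuclideanSpace.single j (1 : ℝ) ∈ Set.range f := by
  have hrank : 1 < Module.rank ℝ (EuclideanSpace ℝ (Fin d)) := by
    rw [← Module.finrank_eq_rank, finrank_euclideanSpace_fin]
    exact_mod_cast hd
  have hinf : (Metric.sphere (0 : EuclideanSpace ℝ (Fin d)) 1).Infinite := by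
    -- In dimension at least `2` the sphere is connected with two distinct points, hence infinite,
    -- so the basis can be padded to `K` arms.
    refine (isPreconnected_sphere hrank 0 1).infinite_of_nontrivial
      ⟨EuclideanSpace.single ⟨0, by omega⟩ 1, by simp, EuclideanSpace.single ⟨1, by omega⟩ 1,
        by simp, fun h => ?_⟩
    simpa using congrArg (fun x : EuclideanSpace ℝ (Fin d) => x ⟨0, by omega⟩) h
  obtain ⟨s, hsub, hs, hcard⟩ := hinf.exists_superset_ncard_eq
    (s := Set.range fun j : Fin d => EuclideanSpace.single j (1 : ℝ))
    (by rintro _ ⟨j, rfl⟩; simp) (Set.finite_range _) (k := K) (by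
      refine le_trans ?_ hK
      rw [← Set.image_univ]
      exact (Set.ncard_image_le Set.finite_univ).trans (by simp))
  -- Infinite sets have `ncard` equal to `0`, which `K ≥ 2` rules out.
  have hfin : s.Finite := Set.finite_of_ncard_pos (by omega)
  have := hfin.fintype
  have e : Fin K ≃ s := (Fintype.equivFinOfCardEq (by
    rw [← Nat.card_eq_fintype_card, Nat.card_coe_set_eq, hcard])).symm
  refine ⟨fun k => e k, Subtype.val_injective.comp e.injective,
    fun k => mem_sphere_zero_iff_norm.1 (hs (e k).2), fun j => ?_⟩
  exact ⟨e.symm ⟨_, hsub ⟨j, rfl⟩⟩, by simp⟩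

theorem exists_setting {d K : ℕ} (M : ℕ) {C : ℝ} (hC : C < 1) (hd : 2 ≤ d) (hK : d ≤ K) :
    ∃ S : Setting d M K, S.RichKeyTerms C ∧
      ∀ i j, EuclideanSpace.single j (1 : ℝ) ∈ Set.range (S.arm i) := by
  obtain ⟨f, hinj, hnorm, hmem⟩ := exists_arms hd hK
  obtain ⟨s, hs1, hs⟩ := exists_finite_rich d hC
  refine ⟨
    { arm := fun _ => f
      arm_injective := fun _ => hinj
      arm_norm := fun _ => hnorm
      arm_span := fun _ => ?_
      numKeys := s.card
      key := fun j => s.equivFin.symm j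
      key_injective := Subtype.val_injective.comp s.equivFin.symm.injective
      key_norm := fun j => hs1 _ (s.equivFin.symm j).2 }, fun v hv => ?_, fun _ => hmem⟩
  · refine top_unique ?_
    rw [← (EuclideanSpace.basisFun (Fin d) ℝ).toBasis.span_eq]
    refine Submodule.span_mono ?_
    rintro _ ⟨j, rfl⟩
    simpa using hmem j
  · obtain ⟨x, hx, hxv⟩ := hs v hv
    exact ⟨s.equivFin ⟨x, hx⟩, by simpa using hxv⟩

end FedBandit

end

theorem theorem2 :
    ∃ c : ℝ, 0 < c ∧
      ∀ C : ℝ, 0 < C → C < 1 →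
      ∀ d M K T : ℕ, 2 ≤ d → d ≤ K → d ≤ M * T →
      ∀ π : (S : FedBandit.Setting d M K) → FedBandit.Policy S,
      ∃ (S : FedBandit.Setting d M K) (E : FedBandit.Environment d),
        S.RichKeyTerms C ∧
        E.armNoise = ProbabilityTheory.gaussianReal 0 1 ∧
        E.keyNoise = ProbabilityTheory.gaussianReal 0 1 ∧
        c * Real.sqrt ((d : ℝ) * M * T) ≤ FedBandit.expectedRegret S E (π S) T := by
  -- `7/1000 = (7/50) · (1/20)`, the second factor coming from `Δ`.
  refine ⟨7 / 1000, by norm_num, fun C _ hC d M K T hd hK hMT π => ?_⟩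
  obtain ⟨S, hrich, hS⟩ := FedBandit.exists_setting M hC hd hK
  have hd' : (2 : ℝ) ≤ d := by exact_mod_cast hd
  have hMT' : (d : ℝ) ≤ M * T := by exact_mod_cast hMT
  have hpos : (0 : ℝ) < M * T := by linarith
  have h1 : Real.sqrt (d / (M * T)) ≤ 1 := by
    rw [Real.sqrt_le_iff]
    exact ⟨zero_le_one, by simpa using div_le_one_of_le₀ hMT' hpos.le⟩
  have hsq : Real.sqrt (d / (M * T)) ^ 2 = d / (M * T) := Real.sq_sqrt (by positivity)
  -- This `Δ` makes `Δ² MT = d/400`, the largest value allowed; `d ≤ MT` keeps it below `1`.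
  obtain ⟨j, hj⟩ := FedBandit.exists_le_expectedRegret S (π S) hd hS T
    (Δ := Real.sqrt (d / (M * T)) / 20) (by positivity) (by linarith) (by
      rw [div_pow, hsq, div_right_comm, div_mul_cancel₀ _ hpos.ne']
      norm_num)
  refine ⟨S, _, hrich, rfl, rfl, le_trans (le_of_eq ?_) hj⟩
  have : Real.sqrt ((d : ℝ) * M * T) = Real.sqrt (d / (M * T)) * (M * T) := by
    rw [← Real.sqrt_sq hpos.le, ← Real.sqrt_mul (by positivity), Real.sqrt_sq hpos.le]
    congr 1
    field_simp
  rw [this]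
  ring
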